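/- Theorem 1. For every real $p>1$ there is a $C^\infty$ function $u:\mathbb R\to\mathbb R$ with $u(x)>0$ for all $x\in\mathbb R$ that satisfies the advance-delay equation $$u''(x)=u^p(x+1)-2u^p(x)+u^p(x-1)\qquad\text{for all }x\in\mathbb R,$$ and such that - $u$ is even, - $u$ is bell-shaped, i.e. $u$ is non-decreasing on $(-\infty,0)$ and non-increasing on $(0,\infty)$, - $u\in H^\infty(\mathbb R)=\bigcap_{s} H^s(\mathbb R)$, where $H^s(\mathbb R)$ is the $L^2$-based Sobolev space of order $s$. -/

import Mathlib

open scoped SchwartzMap ContDiff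

/-- A function on `ℝ` is bell-shaped if it is non-decreasing on `(-∞, 0)` and non-increasing on
`(0, ∞)`. -/
def IsBellShaped (u : ℝ → ℝ) : Prop :=
  MonotoneOn u (Set.Iio 0) ∧ AntitoneOn u (Set.Ioi 0)

/-- `u ∈ H^∞(ℝ)`, the intersection of all the Sobolev spaces `H^s(ℝ)`: the (complexified) function
`u` is square integrable and the tempered distribution that it defines lies in the `L²`-based
Sobolev space of every order `s`. -/
def MemHInfty (u : ℝ → ℝ) : Prop :=
  ∃ hu : MeasureTheory.MemLp (fun x : ℝ => (u x : ℂ)) 2 MeasureTheory.volume,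
    ∀ s : ℝ, TemperedDistribution.MemSobolev s 2
      (MeasureTheory.Lp.toTemperedDistribution hu.toLp : 𝓢'(ℝ, ℂ))

/-- `u` is a classical (smooth) solution on all of `ℝ` of the advance-delay equation
`u''(x) = u^p(x+1) - 2 u^p(x) + u^p(x-1)`. -/
def SolvesAdvanceDelay (p : ℝ) (u : ℝ → ℝ) : Prop :=
  ContDiff ℝ ∞ u ∧
    ∀ x : ℝ, deriv (deriv u) x = u (x + 1) ^ p - 2 * u x ^ p + u (x - 1) ^ p

/-!
Integrating twice, `u'' = u^p(· + 1) - 2 u^p + u^p(· - 1)` follows from `u = A A u^p`, where `A` is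
the moving average over an interval of length one (so `A A` is the convolution with the triangle
function), since `(A f)'(x) = f(x + 1/2) - f(x - 1/2)`. A solution of this fixed point equation comes
from a variational problem: maximize `∫ (A w)²` over the even functions `w ≥ 0` that are
non-increasing in `|x|` and satisfy `∫ w^q ≤ 1`, with `q = 1 + 1/p ∈ (1, 2)`.

* All competitors lie below the envelope `(2|x|)^(-1/q)`, which is locally integrable and has finite
  energy because `1/2 < 1/q < 1`. So Helly's selection principle and dominated convergence give a
  maximizer `w` (`exists_energy_maximizer`).
* The class of competitors is preserved by `A` (`Bell.avg`) and by increasing maps. Hence the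
  normalised function `w' = (c A A w)^p` is a competitor, and no variation inside the cone of
  competitors is needed: the energy is a positive semidefinite form, so `w` has at least as large a
  pairing with `A A w` as `w'` has, while `w'` is the only maximizer of this pairing by Young's
  inequality. Thus `w = w'` almost everywhere (`exists_eulerLagrange`), and a rescaling gives `u`.
* Positivity of `u` makes `u^p` as smooth as `u`, and `A A` gains two derivatives; hence `u` is
  smooth.
* For membership in every Sobolev space it is shown that `u` is a Schwartz function. When `p` is not
  an integer the derivatives of `u^p` contain negative powers of `u`, so the decay of `u` alone does
  not suffice. The remedy is the Harnack-type bound `u(t)^p ≤ C exp(K|x|) u(x)` for `|t - x| ≤ 1`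
  (`IsIntegralSolution.exists_rpow_le`): the ratio `u(x-1)^p / u(x)` grows at most by a constant
  factor per unit step (`IsIntegralSolution.mul_rpow_le`). By induction every derivative of `u` is
  then at most `C exp(K|x|) u(x)`, whereas `u` decays faster than any exponential, as
  `u(x) ≤ u(x-1)^p`.
-/

namespace AdvanceDelay

open MeasureTheory Set Filter Topology
open scoped ENNReal

/-! ### Bells and moving averages -/

/-- An extended non-negative function on `ℝ` is a *bell* if it is even and non-increasing in `|x|`;
the value `∞` is allowed. -/
def Bell (f : ℝ → ℝ≥0∞) : Prop := ∀ x y, |x| ≤ |y| → f y ≤ f x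

/-- The moving average of `f` over the interval of length one centred at `x`. -/
noncomputable def avg (f : ℝ → ℝ≥0∞) (x : ℝ) : ℝ≥0∞ :=
  ∫⁻ t in Icc (x - 1 / 2) (x + 1 / 2), f t

lemma Bell.antitone_comp_max {f : ℝ → ℝ≥0∞} (hf : Bell f) : Antitone fun t : ℝ => f (max t 0) :=
  fun s t hst => hf _ _ (by
    rw [abs_of_nonneg (le_max_right s 0), abs_of_nonneg (le_max_right t 0)]
    exact max_le_max_right 0 hst)

lemma Bell.measurable {f : ℝ → ℝ≥0∞} (hf : Bell f) : Measurable f := by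
  have h2 : f = (fun t : ℝ => f (max t 0)) ∘ fun x : ℝ => |x| := by
    funext x
    have h0 : max |x| 0 = |x| := max_eq_left (abs_nonneg x)
    simp only [Function.comp, h0]
    exact le_antisymm (hf _ _ (by simp)) (hf _ _ (by simp))
  rw [h2]
  exact hf.antitone_comp_max.measurable.comp measurable_norm

lemma Bell.comp_monotone {f : ℝ → ℝ≥0∞} (hf : Bell f) {g : ℝ≥0∞ → ℝ≥0∞} (hg : Monotone g) :
    Bell fun x => g (f x) := fun x y h => hg (hf x y h)

lemma avg_mono {f g : ℝ → ℝ≥0∞} (h : ∀ x, f x ≤ g x) (x : ℝ) : avg f x ≤ avg g x :=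
  lintegral_mono h

lemma avg_congr_ae {f g : ℝ → ℝ≥0∞} (h : f =ᵐ[volume] g) : avg f = avg g := by
  funext x
  exact lintegral_congr_ae (ae_restrict_of_ae h)

lemma avg_const_mul (c : ℝ≥0∞) {f : ℝ → ℝ≥0∞} (hf : Measurable f) :
    avg (fun x => c * f x) = fun x => c * avg f x := by
  funext x
  exact lintegral_const_mul c hf

lemma avg_le_of_forall_le {f : ℝ → ℝ≥0∞} {x : ℝ} {c : ℝ≥0∞} (h : ∀ t, |t - x| ≤ 1 / 2 → f t ≤ c) :
    avg f x ≤ c := by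
  calc avg f x ≤ ∫⁻ _ in Icc (x - 1 / 2) (x + 1 / 2), c :=
        setLIntegral_mono measurable_const fun t ht => h t (by
          rw [abs_le]; constructor <;> linarith [ht.1, ht.2])
    _ = c := by
        rw [setLIntegral_const, Real.volume_Icc]
        norm_num

/-- The reflection `t ↦ x + y - t` exchanges the two windows; on the part of the window around `x`
that is not in the window around `y` it moves points away from the origin. -/
lemma Bell.avg {f : ℝ → ℝ≥0∞} (hf : Bell f) : Bell (avg f) := by
  intro x y hxy
  unfold AdvanceDelay.avg
  set S := Icc (x - 1 / 2) (x + 1 / 2) with hS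
  set T := Icc (y - 1 / 2) (y + 1 / 2) with hT
  have hSm : MeasurableSet S := measurableSet_Icc
  have hTm : MeasurableSet T := measurableSet_Icc
  rw [← lintegral_inter_add_sdiff f T hSm, ← lintegral_inter_add_sdiff f S hTm, inter_comm T S]
  gcongr 1
  have hpre : (fun t => x + y - t) ⁻¹' (T \ S) = S \ T := by
    ext t
    simp only [hS, hT, mem_preimage, Set.mem_sdiff, mem_Icc]
    constructor <;> rintro ⟨⟨h1, h2⟩, h3⟩ <;>
      refine ⟨⟨by linarith, by linarith⟩, fun h4 => h3 ⟨by linarith [h4.2], by linarith [h4.1]⟩⟩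
  have hmp : MeasurePreserving (fun t : ℝ => x + y - t) volume volume :=
    Measure.measurePreserving_sub_left volume (x + y)
  rw [← hmp.setLIntegral_comp_preimage (hTm.diff hSm) hf.measurable, hpre]
  refine setLIntegral_mono hf.measurable fun t ht => hf _ _ ?_
  rw [← sq_le_sq] at hxy ⊢
  obtain ⟨⟨h1, h2⟩, h3⟩ := ht
  simp only [hT, mem_Icc, not_and_or, not_le] at h3
  rcases h3 with h3 | h3
  · nlinarith [sq_nonneg (x + y)]
  · nlinarith [sq_nonneg (x + y)]

/-- Averaging is symmetric for the pairing `⟨f, g⟩ = ∫ f g`. -/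
lemma lintegral_avg_mul {f g : ℝ → ℝ≥0∞} (hf : Measurable f) (hg : Measurable g) :
    ∫⁻ x, avg f x * g x = ∫⁻ x, f x * avg g x := by
  have hset : MeasurableSet {z : ℝ × ℝ | |z.2 - z.1| ≤ 1 / 2} :=
    measurableSet_le (by fun_prop) measurable_const
  have key : ∀ (f : ℝ → ℝ≥0∞) (x : ℝ), avg f x =
      ∫⁻ t, ({z : ℝ × ℝ | |z.2 - z.1| ≤ 1 / 2}.indicator 1 (x, t)) * f t := by
    intro f x
    rw [avg, ← lintegral_indicator measurableSet_Icc]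
    refine lintegral_congr fun t => ?_
    have : t ∈ Icc (x - 1 / 2) (x + 1 / 2) ↔ |t - x| ≤ 1 / 2 := by
      rw [mem_Icc, abs_le]
      constructor <;> rintro ⟨h1, h2⟩ <;> constructor <;> linarith
    by_cases h : |t - x| ≤ 1 / 2
    · rw [indicator_of_mem (this.2 h), indicator_of_mem (by exact h)]; simp
    · rw [indicator_of_notMem (fun h' => h (this.1 h')), indicator_of_notMem (by exact h)]; simp
  have hk : Measurable ({z : ℝ × ℝ | |z.2 - z.1| ≤ 1 / 2}.indicator (1 : ℝ × ℝ → ℝ≥0∞)) :=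
    measurable_one.indicator hset
  set k := {z : ℝ × ℝ | |z.2 - z.1| ≤ 1 / 2}.indicator (1 : ℝ × ℝ → ℝ≥0∞) with hkdef
  have hsymm : ∀ x t, k (x, t) = k (t, x) := by
    intro x t
    simp only [hkdef, indicator, mem_ofPred_eq, abs_sub_comm t x, Pi.one_apply]
  have hm : ∀ x, Measurable fun t => k (x, t) := fun x => hk.comp measurable_prodMk_left
  calc ∫⁻ x, avg f x * g x = ∫⁻ x, ∫⁻ t, k (x, t) * f t * g x := by
        refine lintegral_congr fun x => ?_
        rw [key]
        exact (lintegral_mul_const (g x) ((hm x).mul hf)).symm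
    _ = ∫⁻ t, ∫⁻ x, k (x, t) * f t * g x := by
        refine lintegral_lintegral_swap (Measurable.aemeasurable ?_)
        exact (hk.mul (hf.comp measurable_snd)).mul (hg.comp measurable_fst)
    _ = ∫⁻ t, f t * avg g t := by
        refine lintegral_congr fun t => ?_
        rw [key]
        refine Eq.trans (lintegral_congr fun x => ?_) (lintegral_const_mul (f t) ((hm t).mul hg))
        rw [hsymm x t]; ring

/-- Chebyshev's inequality for a bell, on the interval `(-|x|, |x|)`. -/
lemma Bell.mul_rpow_le {f : ℝ → ℝ≥0∞} (hf : Bell f) {r : ℝ} (hr : 0 ≤ r) (x : ℝ) :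
    ENNReal.ofReal (2 * |x|) * f x ^ r ≤ ∫⁻ t, f t ^ r := by
  calc ENNReal.ofReal (2 * |x|) * f x ^ r = ∫⁻ _ in Icc (-|x|) |x|, f x ^ r := by
        rw [setLIntegral_const, Real.volume_Icc, mul_comm]; ring_nf
    _ ≤ ∫⁻ t in Icc (-|x|) |x|, f t ^ r :=
        setLIntegral_mono (hf.measurable.pow_const r) fun t ht =>
          ENNReal.rpow_le_rpow (hf _ _ (abs_le.2 ht)) hr
    _ ≤ ∫⁻ t, f t ^ r := setLIntegral_le_lintegral _ _

/-! ### Common bounds for the bells of a Lebesgue ball -/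

/-- The upper envelope `(2|x|)⁻ˢ` of the bells in the unit ball of `L^{1/s}`; for `s > 0` it is `∞`
at the origin. -/
noncomputable def envelope (s : ℝ) (x : ℝ) : ℝ≥0∞ := ENNReal.ofReal (2 * |x|) ^ (-s)

/-- The integrable comparison profile `(1 + |x|)⁻ˢ`. -/
noncomputable def profile (s : ℝ) (x : ℝ) : ℝ≥0∞ := ENNReal.ofReal ((1 + |x|) ^ (-s))

lemma Bell.le_envelope {f : ℝ → ℝ≥0∞} (hf : Bell f) {r : ℝ} (hr : 0 < r)
    (h : ∫⁻ t, f t ^ r ≤ 1) (x : ℝ) : f x ≤ envelope r⁻¹ x := by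
  have h1 : ENNReal.ofReal (2 * |x|) * f x ^ r ≤ 1 := (hf.mul_rpow_le hr.le x).trans h
  have h2 : f x ^ r ≤ (ENNReal.ofReal (2 * |x|))⁻¹ := by
    rw [ENNReal.le_inv_iff_mul_le, mul_comm]; exact h1
  have h3 := ENNReal.rpow_le_rpow h2 (inv_nonneg.2 hr.le)
  rw [← ENNReal.rpow_mul, mul_inv_cancel₀ hr.ne', ENNReal.rpow_one] at h3
  rwa [envelope, ENNReal.rpow_neg, ← ENNReal.inv_rpow]

lemma bell_envelope {s : ℝ} (hs : 0 ≤ s) : Bell (envelope s) := by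
  intro x y h
  rw [envelope, envelope, ENNReal.rpow_neg, ENNReal.rpow_neg, ENNReal.inv_le_inv]
  gcongr

lemma bell_profile {s : ℝ} (hs : 0 ≤ s) : Bell (profile s) := by
  intro x y h
  refine ENNReal.ofReal_le_ofReal (Real.rpow_le_rpow_of_nonpos ?_ (by linarith) (by linarith))
  positivity

lemma lintegral_profile_rpow_lt_top {s r : ℝ} (hr : 0 ≤ r) (h : 1 < s * r) :
    ∫⁻ x, profile s x ^ r < ⊤ := by
  have h1 : ∀ x : ℝ, profile s x ^ r = ENNReal.ofReal ((1 + ‖x‖) ^ (-(s * r))) := by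
    intro x
    rw [profile, ENNReal.ofReal_rpow_of_nonneg (by positivity) hr, ← Real.rpow_mul (by positivity),
      Real.norm_eq_abs, neg_mul]
  simp_rw [h1]
  exact finite_integral_one_add_norm (by simpa using h)

lemma avg_profile_le {s : ℝ} (hs : 0 ≤ s) (x : ℝ) :
    avg (profile s) x ≤ ENNReal.ofReal (2 ^ s) * profile s x := by
  refine avg_le_of_forall_le fun t ht => ?_
  rw [profile, profile, ← ENNReal.ofReal_mul (by positivity)]
  refine ENNReal.ofReal_le_ofReal ?_
  have h1 : (1 + |x|) / 2 ≤ 1 + |t| := by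
    have := abs_sub_abs_le_abs_sub x t
    rw [abs_sub_comm] at this
    linarith [abs_nonneg t]
  have h0 : 0 < (1 + |x|) / 2 := by positivity
  calc (1 + |t|) ^ (-s) ≤ ((1 + |x|) / 2) ^ (-s) :=
        Real.rpow_le_rpow_of_nonpos h0 h1 (by linarith)
    _ = 2 ^ s * (1 + |x|) ^ (-s) := by
        rw [Real.div_rpow (by positivity) (by norm_num), Real.rpow_neg (by norm_num : (0:ℝ) ≤ 2)]
        rw [div_inv_eq_mul, mul_comm]

lemma avg_envelope_zero_lt_top {s : ℝ} (hs : 0 ≤ s) (hs1 : s < 1) : avg (envelope s) 0 < ⊤ := by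
  have h1 : IntervalIntegrable (fun x : ℝ => x ^ (-s)) volume (0:ℝ) (1/2) :=
    intervalIntegral.intervalIntegrable_rpow' (by linarith)
  have h2 : ∫⁻ x in Icc (0:ℝ) (1/2), ENNReal.ofReal (x ^ (-s)) < ⊤ := by
    rw [intervalIntegrable_iff_integrableOn_Icc_of_le (by norm_num)] at h1
    have h3 := h1.2
    rw [hasFiniteIntegral_iff_ofReal] at h3
    · exact h3
    · filter_upwards [ae_restrict_mem measurableSet_Icc] with x hx
      exact Real.rpow_nonneg hx.1 _
  have h3 : ∀ x : ℝ, 0 < x → envelope s x ≤ ENNReal.ofReal (x ^ (-s)) := by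
    intro x hx
    rw [envelope, ENNReal.ofReal_rpow_of_pos (by positivity), abs_of_pos hx]
    exact ENNReal.ofReal_le_ofReal
      (Real.rpow_le_rpow_of_nonpos hx (by linarith) (by linarith))
  have h4 : ∫⁻ x in Icc (0:ℝ) (1/2), envelope s x < ⊤ := by
    refine lt_of_le_of_lt (lintegral_mono_ae ?_) h2
    have : ∀ᵐ x : ℝ, x ≠ 0 := by simp [ae_iff]
    filter_upwards [ae_restrict_mem measurableSet_Icc, ae_restrict_of_ae this] with x hx hx0
    exact h3 x (lt_of_le_of_ne hx.1 hx0.symm)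
  have h5 : ∫⁻ x in Icc (-(1/2):ℝ) 0, envelope s x = ∫⁻ x in Icc (0:ℝ) (1/2), envelope s x := by
    have hmp : MeasurePreserving (fun t : ℝ => -t) volume volume :=
      Measure.measurePreserving_neg volume
    rw [← hmp.setLIntegral_comp_preimage measurableSet_Icc (bell_envelope hs).measurable]
    simp only [envelope, abs_neg]
    congr 2
    ext x
    simp only [mem_preimage, mem_Icc]
    constructor <;> rintro ⟨h1, h2⟩ <;> constructor <;> linarith
  have h6 : avg (envelope s) 0 ≤
      ∫⁻ x in Icc (-(1/2):ℝ) 0 ∪ Icc (0:ℝ) (1/2), envelope s x := by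
    refine lintegral_mono_set fun x hx => ?_
    rcases le_total x 0 with h | h
    · exact Or.inl ⟨by linarith [hx.1], h⟩
    · exact Or.inr ⟨h, by linarith [hx.2]⟩
  refine h6.trans_lt ((lintegral_union_le _ _ _).trans_lt ?_)
  rw [h5]
  exact ENNReal.add_lt_top.2 ⟨h4, h4⟩

lemma exists_avg_envelope_le {s : ℝ} (hs : 0 ≤ s) (hs1 : s < 1) :
    ∃ C : ℝ≥0∞, C ≠ ⊤ ∧ ∀ x, avg (envelope s) x ≤ C * profile s x := by
  refine ⟨(avg (envelope s) 0 + 1) * ENNReal.ofReal (2 ^ s), ?_, fun x => ?_⟩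
  · exact ENNReal.mul_ne_top (ENNReal.add_ne_top.2 ⟨(avg_envelope_zero_lt_top hs hs1).ne, by simp⟩)
      ENNReal.ofReal_ne_top
  have hE := bell_envelope hs
  rw [mul_assoc, profile, ← ENNReal.ofReal_mul (by positivity)]
  have hone : (2:ℝ) ^ s * (1 + |x|) ^ (-s) = ((1 + |x|) / 2) ^ (-s) := by
    rw [Real.div_rpow (by positivity) (by norm_num), Real.rpow_neg (by norm_num : (0:ℝ) ≤ 2)]
    rw [div_inv_eq_mul, mul_comm]
  rw [hone]
  rcases le_total |x| 1 with h | h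
  · have h1 : (1:ℝ≥0∞) ≤ ENNReal.ofReal (((1 + |x|) / 2) ^ (-s)) := by
      rw [← ENNReal.ofReal_one]
      exact ENNReal.ofReal_le_ofReal
        (Real.one_le_rpow_of_pos_of_le_one_of_nonpos (by positivity) (by linarith) (by linarith))
    calc avg (envelope s) x ≤ avg (envelope s) 0 := hE.avg _ _ (by simp)
      _ ≤ (avg (envelope s) 0 + 1) * 1 := by rw [mul_one]; exact le_self_add
      _ ≤ _ := by gcongr
  · have h1 : avg (envelope s) x ≤ envelope s (x / 2) := by
      refine avg_le_of_forall_le fun t ht => hE _ _ ?_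
      have := abs_sub_abs_le_abs_sub x t
      rw [abs_sub_comm] at this
      rw [abs_div, abs_two]
      linarith
    have h2 : envelope s (x / 2) ≤ ENNReal.ofReal (((1 + |x|) / 2) ^ (-s)) := by
      rw [envelope, ENNReal.ofReal_rpow_of_pos (by rw [abs_div, abs_two]; linarith)]
      refine ENNReal.ofReal_le_ofReal
        (Real.rpow_le_rpow_of_nonpos (by positivity) ?_ (by linarith))
      rw [abs_div, abs_two]; linarith
    calc avg (envelope s) x ≤ 1 * ENNReal.ofReal (((1 + |x|) / 2) ^ (-s)) := by
          rw [one_mul]; exact h1.trans h2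
      _ ≤ _ := by gcongr; exact le_add_self

/-- The quadratic form `∫ (avg f)²`, which is the pairing of `f` with its double average. -/
noncomputable def energy (f : ℝ → ℝ≥0∞) : ℝ≥0∞ := ∫⁻ x, avg f x ^ (2:ℝ)

lemma energy_envelope_lt_top {s : ℝ} (hs : 1 / 2 < s) (hs1 : s < 1) :
    energy (envelope s) < ⊤ := by
  obtain ⟨C, hC, h⟩ := exists_avg_envelope_le (by linarith : 0 ≤ s) hs1
  have hp := bell_profile (by linarith : 0 ≤ s)
  calc energy (envelope s) ≤ ∫⁻ x, C ^ (2:ℝ) * profile s x ^ (2:ℝ) := by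
        refine lintegral_mono fun x => ?_
        rw [← ENNReal.mul_rpow_of_nonneg _ _ (by norm_num : (0:ℝ) ≤ 2)]
        exact ENNReal.rpow_le_rpow (h x) (by norm_num)
    _ = C ^ (2:ℝ) * ∫⁻ x, profile s x ^ (2:ℝ) :=
        lintegral_const_mul _ (hp.measurable.pow_const _)
    _ < ⊤ := ENNReal.mul_lt_top (ENNReal.rpow_lt_top_of_nonneg (by norm_num) hC)
        (lintegral_profile_rpow_lt_top (by norm_num) (by linarith))

/-! ### Compactness and maximizers of the energy -/

/-- Helly's selection principle for bells: the limit is taken along a subsequence that converges at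
all rational points, and exceptions occur only at the discontinuities of the limit. -/
lemma exists_subseq_tendsto_bell {f : ℕ → ℝ → ℝ≥0∞} (hf : ∀ n, Bell (f n)) :
    ∃ (g : ℝ → ℝ≥0∞) (φ : ℕ → ℕ), Bell g ∧ StrictMono φ ∧
      ∀ᵐ x : ℝ, Tendsto (fun n => f (φ n) x) atTop (𝓝 (g x)) := by
  obtain ⟨l, φ, hφ, hl⟩ := SeqCompactSpace.tendsto_subseq fun n (r : ℚ) => f n (r : ℝ)
  rw [tendsto_pi_nhds] at hl
  set F : ℝ → ℝ≥0∞ := fun x => limsup (fun n => f (φ n) x) atTop with hF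
  have hFb : Bell F := fun x y h => limsup_le_limsup (Eventually.of_forall fun n => hf _ x y h)
  refine ⟨F, φ, hFb, hφ, ?_⟩
  -- a rational point between `|x|` and `|y|` separates the upper and the lower limit
  have hsep : ∀ x y : ℝ, |x| < |y| → F y ≤ liminf (fun n => f (φ n) x) atTop := by
    intro x y h
    obtain ⟨r, h1, h2⟩ := exists_rat_btwn h
    have hr0 : |(r:ℝ)| = r := abs_of_pos ((abs_nonneg x).trans_lt h1)
    have h3 : F y ≤ l r := by
      rw [← (hl r).limsup_eq]
      exact limsup_le_limsup (Eventually.of_forall fun n => hf _ _ _ (by rw [hr0]; exact h2.le))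
    have h4 : l r ≤ liminf (fun n => f (φ n) x) atTop := by
      rw [← (hl r).liminf_eq]
      exact liminf_le_liminf (Eventually.of_forall fun n => hf _ _ _ (by rw [hr0]; exact h1.le))
    exact h3.trans h4
  have hcount := hFb.antitone_comp_max.countable_not_continuousAt
  set B := {t : ℝ | ¬ContinuousAt (fun t : ℝ => F (max t 0)) t} with hB
  have hbad : (B ∪ (fun t => -t) ⁻¹' B).Countable :=
    hcount.union (hcount.preimage neg_injective)
  filter_upwards [hbad.ae_notMem volume] with x hx
  have hx' : ContinuousAt (fun t : ℝ => F (max t 0)) |x| := by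
    by_contra hcon
    rcases abs_choice x with h | h
    · exact hx (Or.inl (by rw [h] at hcon; exact hcon))
    · exact hx (Or.inr (by rw [h] at hcon; exact hcon))
  have hval : F (max |x| 0) = F x := by
    rw [max_eq_left (abs_nonneg x)]
    exact le_antisymm (hFb _ _ (by simp)) (hFb _ _ (by simp))
  have hlim : Tendsto (fun t : ℝ => F (max t 0)) (𝓝[>] |x|) (𝓝 (F x)) := by
    have := hx'.tendsto
    rw [hval] at this
    exact this.mono_left nhdsWithin_le_nhds
  have hle : F x ≤ liminf (fun n => f (φ n) x) atTop := by
    refine le_of_tendsto hlim ?_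
    filter_upwards [self_mem_nhdsWithin] with t ht
    have ht' : |x| < t := ht
    exact hsep x _ (by
      rw [max_eq_left ((abs_nonneg x).trans ht'.le), abs_of_pos ((abs_nonneg x).trans_lt ht')]
      exact ht')
  exact tendsto_of_le_liminf_of_limsup_le hle le_rfl

/-- The bells in the unit ball of `L^r`. -/
def bellBall (r : ℝ) : Set (ℝ → ℝ≥0∞) := {f | Bell f ∧ ∫⁻ x, f x ^ r ≤ 1}

lemma exists_mem_bellBall_energy_pos {r : ℝ} (hr : 0 < r) : ∃ f ∈ bellBall r, 0 < energy f := by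
  have hb : Bell ((Icc (-(1/2)) (1/2) : Set ℝ).indicator 1) := by
    intro x y h
    by_cases hy : y ∈ Icc (-(1/2)) (1/2 : ℝ)
    · have hx : x ∈ Icc (-(1/2)) (1/2 : ℝ) := abs_le.1 (h.trans (abs_le.2 hy))
      rw [indicator_of_mem hx, indicator_of_mem hy]
      exact le_rfl
    · rw [indicator_of_notMem hy]
      exact bot_le
  refine ⟨_, ⟨hb, le_of_eq ?_⟩, ?_⟩
  · have h1 : ∀ x, (Icc (-(1/2)) (1/2) : Set ℝ).indicator (1 : ℝ → ℝ≥0∞) x ^ r =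
        (Icc (-(1/2)) (1/2) : Set ℝ).indicator (1 : ℝ → ℝ≥0∞) x := by
      intro x
      by_cases hx : x ∈ Icc (-(1/2)) (1/2 : ℝ)
      · rw [indicator_of_mem hx]; simp
      · rw [indicator_of_notMem hx]; simp [hr]
    simp_rw [h1]
    rw [lintegral_indicator_one measurableSet_Icc, Real.volume_Icc]
    norm_num
  · set f := (Icc (-(1/2)) (1/2) : Set ℝ).indicator (1 : ℝ → ℝ≥0∞) with hf
    have h1 : 0 < avg f (1/2) := by
      have h2 : ∫⁻ x in Icc (0:ℝ) (1/2), 1 ≤ avg f (1/2) := by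
        calc ∫⁻ x in Icc (0:ℝ) (1/2), 1 = ∫⁻ x in Icc (0:ℝ) (1/2), f x := by
              refine setLIntegral_congr_fun measurableSet_Icc fun x hx => ?_
              have hx' : x ∈ Icc (-(1/2)) (1/2 : ℝ) := ⟨by linarith [hx.1], hx.2⟩
              rw [hf, indicator_of_mem hx', Pi.one_apply]
          _ ≤ avg f (1/2) := lintegral_mono_set (Icc_subset_Icc (by norm_num) (by norm_num))
      refine lt_of_lt_of_le ?_ h2
      rw [setLIntegral_one, Real.volume_Icc]
      norm_num
    refine lt_of_lt_of_le ?_ (hb.avg.mul_rpow_le (r := 2) (by norm_num) (1/2))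
    refine ENNReal.mul_pos ?_ ?_
    · norm_num
    · exact (ENNReal.rpow_pos_of_nonneg h1 (by norm_num)).ne'

/-- The energy attains its maximum over the bells in the unit ball of `L^r`: by Helly's principle a
maximizing sequence converges almost everywhere, and the common envelope dominates it. -/
lemma exists_energy_maximizer {r : ℝ} (hr : 1 < r) (hr2 : r < 2) :
    ∃ w ∈ bellBall r, energy w ≠ 0 ∧ ∀ f ∈ bellBall r, energy f ≤ energy w := by
  have hr0 : 0 < r := by linarith
  have hs1 : r⁻¹ < 1 := inv_lt_one_of_one_lt₀ hr
  have hs2 : 1 / 2 < r⁻¹ := by rw [one_div]; exact inv_strictAnti₀ hr0 hr2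
  have hs0 : 0 ≤ r⁻¹ := by positivity
  have hG := bell_envelope hs0
  obtain ⟨f₀, hf₀, hpos⟩ := exists_mem_bellBall_energy_pos hr0
  obtain ⟨e, -, he, hmem⟩ := exists_seq_tendsto_sSup (S := energy '' bellBall r)
    ⟨_, mem_image_of_mem _ hf₀⟩ (OrderTop.bddAbove _)
  choose f hf hfe using hmem
  obtain ⟨w, φ, hw, hφ, hlim⟩ := exists_subseq_tendsto_bell fun n => (hf n).1
  have hle : ∀ n x, f n x ≤ envelope r⁻¹ x := fun n => (hf n).1.le_envelope hr0 (hf n).2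
  -- the averages converge everywhere, because the envelope is locally integrable
  have havg : ∀ x, Tendsto (fun n => avg (f (φ n)) x) atTop (𝓝 (avg w x)) := by
    intro x
    refine tendsto_lintegral_of_dominated_convergence (envelope r⁻¹)
      (fun n => (hf (φ n)).1.measurable) (fun n => Eventually.of_forall (hle (φ n))) ?_
      (ae_restrict_of_ae hlim)
    exact ((hG.avg 0 x (by simp)).trans_lt (avg_envelope_zero_lt_top hs0 hs1)).ne
  have hen : Tendsto (fun n => energy (f (φ n))) atTop (𝓝 (energy w)) := by
    refine tendsto_lintegral_of_dominated_convergence (fun x => avg (envelope r⁻¹) x ^ (2:ℝ))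
      (fun n => (hf (φ n)).1.avg.measurable.pow_const _)
      (fun n => Eventually.of_forall fun x =>
        ENNReal.rpow_le_rpow (avg_mono (hle (φ n)) x) (by norm_num))
      (energy_envelope_lt_top hs2 hs1).ne
      (Eventually.of_forall fun x => (ENNReal.continuous_rpow_const.tendsto _).comp (havg x))
  have hsup : energy w = sSup (energy '' bellBall r) := by
    refine tendsto_nhds_unique hen ?_
    simp_rw [hfe]
    exact he.comp hφ.tendsto_atTop
  have hmax : ∀ f ∈ bellBall r, energy f ≤ energy w := fun g hg => by
    rw [hsup]; exact le_sSup (mem_image_of_mem _ hg)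
  refine ⟨w, ⟨hw, ?_⟩, (hpos.trans_le (hmax _ hf₀)).ne', hmax⟩
  calc ∫⁻ x, w x ^ r = ∫⁻ x, liminf (fun n => f (φ n) x ^ r) atTop := by
        refine lintegral_congr_ae ?_
        filter_upwards [hlim] with x hx
        exact (((ENNReal.continuous_rpow_const.tendsto _).comp hx).liminf_eq).symm
    _ ≤ liminf (fun n => ∫⁻ x, f (φ n) x ^ r) atTop :=
        lintegral_liminf_le fun n => (hf (φ n)).1.measurable.pow_const _
    _ ≤ 1 := by
        refine (liminf_le_liminf (Eventually.of_forall fun n => (hf (φ n)).2)).trans ?_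
        simp

/-! ### The Euler–Lagrange equation -/

/-- The pairing of a maximizer with its own double average dominates the pairing with any other
competitor, because the energy is a positive semidefinite quadratic form. -/
lemma pairing_le_of_energy_le {f g : ℝ → ℝ≥0∞} (hf : Bell f) (hg : Bell g)
    (h : energy g ≤ energy f) :
    ∫⁻ x, avg (avg f) x * g x ≤ ∫⁻ x, avg (avg f) x * f x := by
  have hff : ∫⁻ x, avg (avg f) x * f x = energy f := by
    rw [lintegral_avg_mul hf.avg.measurable hf.measurable]
    refine lintegral_congr fun x => ?_
    rw [ENNReal.rpow_two, sq]
  rw [hff, lintegral_avg_mul hf.avg.measurable hg.measurable]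
  have hpt : ∀ a b : ℝ≥0∞, 2 * (a * b) ≤ a ^ (2:ℝ) + b ^ (2:ℝ) := by
    intro a b
    have h2 := ENNReal.young_inequality a b Real.HolderConjugate.two_two
    calc 2 * (a * b) ≤ 2 * (a ^ (2:ℝ) / ENNReal.ofReal 2 + b ^ (2:ℝ) / ENNReal.ofReal 2) := by
          gcongr
      _ = a ^ (2:ℝ) + b ^ (2:ℝ) := by
          rw [ENNReal.ofReal_ofNat, mul_add, ENNReal.mul_div_cancel (by norm_num) (by norm_num),
            ENNReal.mul_div_cancel (by norm_num) (by norm_num)]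
  have h1 : 2 * ∫⁻ x, avg f x * avg g x ≤ 2 * energy f := by
    calc 2 * ∫⁻ x, avg f x * avg g x = ∫⁻ x, 2 * (avg f x * avg g x) :=
          (lintegral_const_mul _ (hf.avg.measurable.mul hg.avg.measurable)).symm
      _ ≤ ∫⁻ x, (avg f x ^ (2:ℝ) + avg g x ^ (2:ℝ)) := lintegral_mono fun x => hpt _ _
      _ = energy f + energy g := lintegral_add_left (hf.avg.measurable.pow_const _) _
      _ ≤ energy f + energy f := by gcongr
      _ = 2 * energy f := (two_mul _).symm
  exact (ENNReal.mul_le_mul_iff_right (by norm_num) (by norm_num)).1 h1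

/-- Among the competitors, the power `V^p` of a normalised multiple `V` of the double average of a
maximizer `w` has the largest pairing with `V`; equality in Young's inequality then gives the
Euler–Lagrange equation `w = V^p`. -/
lemma exists_eulerLagrange {p : ℝ} (hp : 1 < p) :
    ∃ (v : ℝ → ℝ≥0∞) (c C : ℝ≥0∞), Bell v ∧ c ≠ 0 ∧ c ≠ ⊤ ∧ C ≠ ⊤ ∧ (∃ x, v x ≠ 0) ∧
      (∀ x, v x ≤ C * profile (p / (p + 1)) x) ∧ v = avg (avg fun x => (c * v x) ^ p) := by
  have hp0 : 0 < p := by linarith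
  set r := (p + 1) / p with hr
  have hr1 : 1 < r := by rw [hr, lt_div_iff₀ hp0]; linarith
  have hr2 : r < 2 := by rw [hr, div_lt_iff₀ hp0]; linarith
  have hr0 : 0 < r := by linarith
  have hrinv : r⁻¹ = p / (p + 1) := by rw [hr, inv_div]
  have hpr : p * r = p + 1 := by rw [hr]; field_simp
  have hconj : (p + 1).HolderConjugate r := by
    rw [Real.holderConjugate_iff]
    refine ⟨by linarith, ?_⟩
    rw [hrinv]; field_simp; ring
  obtain ⟨w, hwmem, hw0, hmax⟩ := exists_energy_maximizer hr1 hr2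
  obtain ⟨hw, hwr⟩ := hwmem
  have hwG := hw.le_envelope hr0 hwr
  rw [hrinv] at hwG
  set s := p / (p + 1) with hs
  have hs0 : 0 ≤ s := by positivity
  have hs1 : s < 1 := by rw [hs, div_lt_one (by linarith)]; linarith
  set v := avg (avg w) with hv
  have hvb : Bell v := hw.avg.avg
  obtain ⟨C, hC, hCle⟩ := exists_avg_envelope_le hs0 hs1
  have hvle : ∀ x, v x ≤ C * ENNReal.ofReal (2 ^ s) * profile s x := by
    intro x
    calc v x ≤ avg (fun x => C * profile s x) x :=
          avg_mono (fun y => (avg_mono hwG y).trans (hCle y)) x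
      _ = C * avg (profile s) x := by rw [avg_const_mul C (bell_profile hs0).measurable]
      _ ≤ C * (ENNReal.ofReal (2 ^ s) * profile s x) := by gcongr; exact avg_profile_le hs0 x
      _ = _ := (mul_assoc _ _ _).symm
  set C' := C * ENNReal.ofReal (2 ^ s) with hC'
  have hC'top : C' ≠ ⊤ := ENNReal.mul_ne_top hC ENNReal.ofReal_ne_top
  have hvtop : ∀ x, v x ≠ ⊤ := fun x =>
    ((hvle x).trans_lt (ENNReal.mul_lt_top hC'top.lt_top ENNReal.ofReal_lt_top)).ne
  have hpair : ∫⁻ x, v x * w x = energy w := by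
    rw [hv, lintegral_avg_mul hw.avg.measurable hw.measurable]
    refine lintegral_congr fun x => ?_
    rw [ENNReal.rpow_two, sq]
  set T := ∫⁻ x, v x ^ (p + 1) with hT
  have hTtop : T ≠ ⊤ := by
    refine (lt_of_le_of_lt (b := ∫⁻ x, C' ^ (p + 1) * profile s x ^ (p + 1))
      (lintegral_mono fun x => ?_) ?_).ne
    · rw [← ENNReal.mul_rpow_of_nonneg _ _ (by linarith : 0 ≤ p + 1)]
      exact ENNReal.rpow_le_rpow (hvle x) (by linarith)
    · rw [lintegral_const_mul _ ((bell_profile hs0).measurable.pow_const _)]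
      refine ENNReal.mul_lt_top (ENNReal.rpow_lt_top_of_nonneg (by linarith) hC'top)
        (lintegral_profile_rpow_lt_top (by linarith) ?_)
      rw [hs, div_mul_cancel₀ _ (by linarith)]; exact hp
  have hT0 : T ≠ 0 := by
    intro h
    rw [hT, lintegral_eq_zero_iff (hvb.measurable.pow_const _)] at h
    refine hw0 ?_
    rw [← hpair, lintegral_eq_zero_iff
      (show Measurable fun x => v x * w x from hvb.measurable.mul hw.measurable)]
    filter_upwards [h] with x hx
    have hx' : v x ^ (p + 1) = 0 := hx
    rw [ENNReal.rpow_eq_zero_iff_of_pos (by linarith)] at hx'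
    simp [hx']
  set c := T ^ (-(p + 1)⁻¹) with hc
  have hc0 : c ≠ 0 := by
    rw [hc, ENNReal.rpow_neg]
    exact ENNReal.inv_ne_zero.2 (ENNReal.rpow_ne_top_of_nonneg (by positivity) hTtop)
  have hctop : c ≠ ⊤ := by
    rw [hc, ENNReal.rpow_neg, Ne, ENNReal.inv_eq_top, ENNReal.rpow_eq_zero_iff_of_pos (by positivity)]
    exact hT0
  set V := fun x => c * v x with hV
  have hVb : Bell V := hvb.comp_monotone fun a b h => by gcongr
  have hVnorm : ∫⁻ x, V x ^ (p + 1) = 1 := by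
    have h1 : ∀ x, V x ^ (p + 1) = c ^ (p + 1) * v x ^ (p + 1) := fun x =>
      ENNReal.mul_rpow_of_nonneg _ _ (by linarith)
    simp_rw [h1]
    rw [lintegral_const_mul _ (hvb.measurable.pow_const _), ← hT, hc, ← ENNReal.rpow_mul,
      neg_mul, inv_mul_cancel₀ (by linarith), ENNReal.rpow_neg_one]
    exact ENNReal.inv_mul_cancel hT0 hTtop
  have hVp : Bell fun x => V x ^ p :=
    hVb.comp_monotone fun a b h => ENNReal.rpow_le_rpow h hp0.le
  have hVmem : (fun x => V x ^ p) ∈ bellBall r := by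
    refine ⟨hVp, le_of_eq ?_⟩
    simp_rw [← ENNReal.rpow_mul, hpr]
    exact hVnorm
  have hge : 1 ≤ ∫⁻ x, V x * w x := by
    have h1 := pairing_le_of_energy_le hw hVp (hmax _ hVmem)
    calc 1 = ∫⁻ x, V x * V x ^ p := by
          rw [← hVnorm]
          refine lintegral_congr fun x => ?_
          rw [add_comm p 1, ENNReal.rpow_add_of_nonneg _ _ (by norm_num) hp0.le, ENNReal.rpow_one]
      _ = c * ∫⁻ x, v x * V x ^ p := by
          refine Eq.trans (lintegral_congr fun x => mul_assoc _ _ _)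
            (lintegral_const_mul c (hvb.measurable.mul hVp.measurable))
      _ ≤ c * ∫⁻ x, v x * w x := by gcongr
      _ = ∫⁻ x, V x * w x := by
          refine Eq.trans (lintegral_const_mul c (hvb.measurable.mul hw.measurable)).symm
            (lintegral_congr fun x => (mul_assoc _ _ _).symm)
  set Y := fun x => V x ^ (p + 1) / ENNReal.ofReal (p + 1) + w x ^ r / ENNReal.ofReal r with hY
  have hyoung : ∀ x, V x * w x ≤ Y x := fun x => ENNReal.young_inequality _ _ hconj
  have hYint : ∫⁻ x, Y x ≤ 1 := by
    have h1 : ∫⁻ x, Y x = (∫⁻ x, V x ^ (p + 1)) / ENNReal.ofReal (p + 1) +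
        (∫⁻ x, w x ^ r) / ENNReal.ofReal r := by
      simp only [hY, div_eq_mul_inv]
      rw [lintegral_add_left ((hVb.measurable.pow_const _).mul_const _),
        lintegral_mul_const _ (hVb.measurable.pow_const _),
        lintegral_mul_const _ (hw.measurable.pow_const _)]
    rw [h1, hVnorm]
    calc 1 / ENNReal.ofReal (p + 1) + (∫⁻ x, w x ^ r) / ENNReal.ofReal r
        ≤ 1 / ENNReal.ofReal (p + 1) + 1 / ENNReal.ofReal r := by gcongr
      _ = 1 := by
          rw [one_div, one_div, ← ENNReal.ofReal_inv_of_pos (by linarith),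
            ← ENNReal.ofReal_inv_of_pos hr0, ← ENNReal.ofReal_add (by positivity) (by positivity),
            hconj.inv_add_inv_eq_one, ENNReal.ofReal_one]
  have hYm : Measurable Y := ((hVb.measurable.pow_const _).div_const _).add
    ((hw.measurable.pow_const _).div_const _)
  have hae : (fun x => V x * w x) =ᵐ[volume] Y := by
    refine ae_eq_of_ae_le_of_lintegral_le (Eventually.of_forall hyoung) ?_ hYm.aemeasurable
      (hYint.trans hge)
    exact (((lintegral_mono hyoung).trans hYint).trans_lt ENNReal.one_lt_top).ne
  have hwV : w =ᵐ[volume] fun x => V x ^ p := by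
    have hne : ∀ᵐ x : ℝ, x ≠ 0 := by simp [ae_iff]
    filter_upwards [hae, hne] with x hx hx0
    have hwx : w x ≠ ⊤ := by
      refine ((hwG x).trans_lt ?_).ne
      rw [envelope, ENNReal.ofReal_rpow_of_pos (by positivity)]
      exact ENNReal.ofReal_lt_top
    rcases (ENNReal.young_inequality_eq_iff _ _ hconj).1 hx with h | h | h
    · exact absurd h.1 (ENNReal.mul_ne_top hctop (hvtop x))
    · exact absurd h.2 hwx
    · refine ENNReal.rpow_left_injective hr0.ne' ?_
      simp only
      rw [← h, ← ENNReal.rpow_mul, hpr]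
  refine ⟨v, c, C', hvb, hc0, hctop, hC'top, ?_, hvle, ?_⟩
  · by_contra! hcon
    refine hT0 ?_
    simp [hT, hcon, show 0 < p + 1 by linarith]
  · rw [← avg_congr_ae hwV]

/-- A rescaling normalises the constant in the Euler–Lagrange equation. -/
theorem exists_bell_eq_avg_avg_rpow {p : ℝ} (hp : 1 < p) :
    ∃ (U : ℝ → ℝ≥0∞) (C : ℝ≥0∞), Bell U ∧ C ≠ ⊤ ∧ (∃ x, U x ≠ 0) ∧
      (∀ x, U x ≤ C * profile (p / (p + 1)) x) ∧ U = avg (avg fun x => U x ^ p) := by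
  obtain ⟨v, c, C, hv, hc0, hctop, hC, ⟨x₀, hx₀⟩, hle, heq⟩ := exists_eulerLagrange hp
  have hp0 : 0 < p := by linarith
  have hp1 : 0 < p - 1 := by linarith
  set m := c ^ (p / (p - 1)) with hm
  have hm0 : m ≠ 0 := by
    rw [hm, Ne, ENNReal.rpow_eq_zero_iff_of_pos (by positivity)]; exact hc0
  have hmtop : m ≠ ⊤ := ENNReal.rpow_ne_top_of_nonneg (by positivity) hctop
  have hmp : m ^ p = m * c ^ p := by
    rw [hm, ← ENNReal.rpow_mul, ← ENNReal.rpow_add_of_nonneg _ _ (by positivity) hp0.le]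
    congr 1
    field_simp
    ring
  refine ⟨fun x => m * v x, m * C, hv.comp_monotone (g := fun a => m * a) fun a b h =>
    mul_le_mul_right h m,
    ENNReal.mul_ne_top hmtop hC, ⟨x₀, mul_ne_zero hm0 hx₀⟩, fun x => ?_, ?_⟩
  · rw [mul_assoc m C]; exact mul_le_mul_right (hle x) m
  · have hvp : Bell fun x => v x ^ p :=
      hv.comp_monotone fun a b h => ENNReal.rpow_le_rpow h hp0.le
    have h1 : ∀ d : ℝ≥0∞, avg (avg fun x => (d * v x) ^ p) =
        fun x => d ^ p * avg (avg fun x => v x ^ p) x := by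
      intro d
      simp_rw [ENNReal.mul_rpow_of_nonneg _ _ hp0.le]
      rw [avg_const_mul _ hvp.measurable, avg_const_mul _ hvp.avg.measurable]
    rw [h1 m, hmp]
    rw [h1 c] at heq
    funext x
    rw [mul_assoc, ← congrFun heq x]

/-! ### Moving averages of real functions -/

/-- The moving average of a real function over the interval of length one centred at `x`. -/
noncomputable def realAvg (f : ℝ → ℝ) (x : ℝ) : ℝ := ∫ t in (x - 1 / 2)..(x + 1 / 2), f t

lemma realAvg_eq_sub {f : ℝ → ℝ} (hf : ∀ a b, IntervalIntegrable f volume a b) :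
    realAvg f =
      fun x => (∫ t in (0:ℝ)..(x + 1 / 2), f t) - ∫ t in (0:ℝ)..(x - 1 / 2), f t :=
  funext fun _ => (intervalIntegral.integral_interval_sub_left (hf _ _) (hf _ _)).symm

lemma continuous_realAvg {f : ℝ → ℝ} (hf : ∀ a b, IntervalIntegrable f volume a b) :
    Continuous (realAvg f) := by
  have h := intervalIntegral.continuous_primitive hf 0
  rw [realAvg_eq_sub hf]
  exact (h.comp (by fun_prop)).sub (h.comp (by fun_prop))

lemma hasDerivAt_realAvg {f : ℝ → ℝ} (hf : Continuous f) (x : ℝ) :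
    HasDerivAt (realAvg f) (f (x + 1 / 2) - f (x - 1 / 2)) x := by
  have h : ∀ y, HasDerivAt (fun z => ∫ t in (0:ℝ)..z, f t) (f y) y := fun y =>
    intervalIntegral.integral_hasDerivAt_right (hf.intervalIntegrable _ _)
      (hf.stronglyMeasurableAtFilter _ _) hf.continuousAt
  rw [realAvg_eq_sub fun a b => hf.intervalIntegrable a b]
  exact ((h _).comp_add_const x (1 / 2)).sub ((h _).comp_sub_const x (1 / 2))

lemma deriv_realAvg {f : ℝ → ℝ} (hf : Continuous f) :
    deriv (realAvg f) = fun x => f (x + 1 / 2) - f (x - 1 / 2) :=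
  funext fun x => (hasDerivAt_realAvg hf x).deriv

lemma contDiff_realAvg {f : ℝ → ℝ} {n : ℕ} (hf : ContDiff ℝ n f) :
    ContDiff ℝ (n + 1 : ℕ) (realAvg f) := by
  push_cast
  rw [contDiff_succ_iff_deriv]
  refine ⟨fun x => (hasDerivAt_realAvg hf.continuous x).differentiableAt, by simp, ?_⟩
  rw [deriv_realAvg hf.continuous]
  exact (hf.comp (by fun_prop)).sub (hf.comp (by fun_prop))

lemma iteratedDeriv_succ_realAvg {f : ℝ → ℝ} {n : ℕ} (hf : ContDiff ℝ n f) (x : ℝ) :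
    iteratedDeriv (n + 1) (realAvg f) x =
      iteratedDeriv n f (x + 1 / 2) - iteratedDeriv n f (x - 1 / 2) := by
  rw [iteratedDeriv_succ', deriv_realAvg hf.continuous]
  have h1 : ContDiff ℝ n fun x => f (x + 1 / 2) := hf.comp (by fun_prop)
  have h2 : ContDiff ℝ n fun x => f (x - 1 / 2) := hf.comp (by fun_prop)
  rw [iteratedDeriv_fun_sub h1.contDiffAt h2.contDiffAt, iteratedDeriv_comp_add_const,
    iteratedDeriv_comp_sub_const]

lemma realAvg_le {f : ℝ → ℝ} (hf : Continuous f) {x c : ℝ} (h : ∀ t, |t - x| ≤ 1 / 2 → f t ≤ c) :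
    realAvg f x ≤ c := by
  have h1 := intervalIntegral.integral_mono_on (a := x - 1 / 2) (b := x + 1 / 2) (by linarith)
    (hf.intervalIntegrable (μ := volume) _ _) (intervalIntegrable_const (c := c))
    fun t ht => h t (by rw [abs_le]; constructor <;> linarith [ht.1, ht.2])
  rw [intervalIntegral.integral_const, smul_eq_mul] at h1
  unfold realAvg
  linarith

lemma realAvg_nonneg {f : ℝ → ℝ} (h : ∀ x, 0 ≤ f x) (x : ℝ) : 0 ≤ realAvg f x :=
  intervalIntegral.integral_nonneg (by linarith) fun t _ => h t

lemma antitoneOn_realAvg {f : ℝ → ℝ} (hf : Continuous f) {c : ℝ} (h : AntitoneOn f (Ici c)) :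
    AntitoneOn (realAvg f) (Ici (c + 1 / 2)) := by
  intro x hx y hy hxy
  simp only [mem_Ici] at hx hy
  have hcv : ∀ z, realAvg f z = ∫ t in (-(1/2):ℝ)..(1/2), f (t + z) := by
    intro z
    rw [intervalIntegral.integral_comp_add_right, realAvg]
    congr 1 <;> ring
  rw [hcv, hcv]
  refine intervalIntegral.integral_mono_on (by norm_num)
    (Continuous.intervalIntegrable (by fun_prop) _ _)
    (Continuous.intervalIntegrable (by fun_prop) _ _) fun t ht => h ?_ ?_ (by linarith)
  · simp only [mem_Ici]; linarith [ht.1]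
  · simp only [mem_Ici]; linarith [ht.1]

lemma mul_le_realAvg {f : ℝ → ℝ} (hf : Continuous f) (h0 : ∀ x, 0 ≤ f x) {c : ℝ}
    (h : AntitoneOn f (Ici c)) {x k : ℝ} (hx : c + 1 / 2 ≤ x) (hk0 : 0 ≤ k) (hk1 : k ≤ 1) :
    k * f (x - 1 / 2 + k) ≤ realAvg f x := by
  have hi : ∀ a b, IntervalIntegrable f volume a b := fun a b => hf.intervalIntegrable a b
  have h1 := intervalIntegral.integral_mono_on (a := x - 1 / 2) (b := x - 1 / 2 + k) (by linarith)
    (intervalIntegrable_const (c := f (x - 1 / 2 + k)) (μ := volume)) (hi _ _)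
    fun t ht => h (by simp only [mem_Ici]; linarith [ht.1]) (by simp only [mem_Ici]; linarith) ht.2
  rw [intervalIntegral.integral_const, smul_eq_mul, add_sub_cancel_left] at h1
  have h2 : 0 ≤ ∫ t in (x - 1 / 2 + k)..(x + 1 / 2), f t :=
    intervalIntegral.integral_nonneg (by linarith) fun t _ => h0 t
  have h3 := intervalIntegral.integral_add_adjacent_intervals (hi (x - 1 / 2) (x - 1 / 2 + k))
    (hi (x - 1 / 2 + k) (x + 1 / 2))
  unfold realAvg
  linarith

lemma realAvg_sub_le {f : ℝ → ℝ} (hf : Continuous f) (h0 : ∀ x, 0 ≤ f x) {c : ℝ}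
    (h : AntitoneOn f (Ici c)) {x k : ℝ} (hx : c + 1 / 2 ≤ x) (hk0 : 0 ≤ k) :
    realAvg f x - realAvg f (x + k) ≤ k * f (x - 1 / 2) := by
  have hi : ∀ a b, IntervalIntegrable f volume a b := fun a b => hf.intervalIntegrable a b
  have h1 := intervalIntegral.integral_mono_on (a := x - 1 / 2) (b := x + k - 1 / 2) (by linarith)
    (hi _ _) (intervalIntegrable_const (c := f (x - 1 / 2)) (μ := volume))
    fun t ht => h (by simp only [mem_Ici]; linarith) (by simp only [mem_Ici]; linarith [ht.1]) ht.1
  rw [intervalIntegral.integral_const, smul_eq_mul] at h1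
  have h2 : 0 ≤ ∫ t in (x + 1 / 2)..(x + k + 1 / 2), f t :=
    intervalIntegral.integral_nonneg (by linarith) fun t _ => h0 t
  have h3 := intervalIntegral.integral_add_adjacent_intervals (hi (x - 1 / 2) (x + k - 1 / 2))
    (hi (x + k - 1 / 2) (x + k + 1 / 2))
  have h4 := intervalIntegral.integral_add_adjacent_intervals (hi (x - 1 / 2) (x + 1 / 2))
    (hi (x + 1 / 2) (x + k + 1 / 2))
  have h5 : x + k - 1 / 2 - (x - 1 / 2) = k := by ring
  rw [h5] at h1
  unfold realAvg
  linarith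

lemma avg_ofReal {f : ℝ → ℝ} (hf : ∀ a b, IntervalIntegrable f volume a b) (h0 : ∀ x, 0 ≤ f x)
    (x : ℝ) : avg (fun t => ENNReal.ofReal (f t)) x = ENNReal.ofReal (realAvg f x) := by
  have hle : x - 1 / 2 ≤ x + 1 / 2 := by linarith
  have hi := (intervalIntegrable_iff_integrableOn_Icc_of_le hle).1 (hf (x - 1 / 2) (x + 1 / 2))
  rw [realAvg, intervalIntegral.integral_of_le hle, ← integral_Icc_eq_integral_Ioc,
    ofReal_integral_eq_lintegral_ofReal hi (Eventually.of_forall h0), avg]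

/-! ### The integral form of the problem -/

/-- The integral form of the problem: a non-trivial continuous non-negative function, even,
non-increasing in `|x|` and vanishing at infinity, that equals the double average of its `p`-th
power. The double average is the convolution with the triangle function `max(0, 1 - |x|)`. -/
structure IsIntegralSolution (p : ℝ) (u : ℝ → ℝ) : Prop where
  continuous : Continuous u
  nonneg : ∀ x, 0 ≤ u x
  bell : ∀ x y, |x| ≤ |y| → u y ≤ u x
  tendsto_zero : Tendsto u atTop (𝓝 0)
  exists_ne_zero : ∃ x, u x ≠ 0
  eq_realAvg : u = realAvg (realAvg fun x => u x ^ p)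

theorem exists_isIntegralSolution {p : ℝ} (hp : 1 < p) : ∃ u, IsIntegralSolution p u := by
  obtain ⟨U, C, hU, hC, ⟨x₀, hx₀⟩, hle, heq⟩ := exists_bell_eq_avg_avg_rpow hp
  have hp0 : 0 < p := by linarith
  have hUtop : ∀ x, U x ≠ ⊤ := fun x =>
    ((hle x).trans_lt (ENNReal.mul_lt_top hC.lt_top ENNReal.ofReal_lt_top)).ne
  set u := fun x => (U x).toReal with hu
  have hUu : ∀ x, U x = ENNReal.ofReal (u x) := fun x => (ENNReal.ofReal_toReal (hUtop x)).symm
  have hu0 : ∀ x, 0 ≤ u x := fun x => ENNReal.toReal_nonneg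
  have hbell : ∀ x y, |x| ≤ |y| → u y ≤ u x := fun x y h =>
    ENNReal.toReal_mono (hUtop x) (hU x y h)
  have hf0 : ∀ x, 0 ≤ u x ^ p := fun x => Real.rpow_nonneg (hu0 x) p
  have hfi : ∀ a b, IntervalIntegrable (fun x => u x ^ p) volume a b := by
    intro a b
    refine (intervalIntegrable_const (c := u 0 ^ p)).mono_fun
      (hU.measurable.ennreal_toReal.pow_const p).aestronglyMeasurable
      (Eventually.of_forall fun x => ?_)
    simp only
    rw [Real.norm_of_nonneg (hf0 x), Real.norm_of_nonneg (hf0 0)]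
    exact Real.rpow_le_rpow (hu0 x) (hbell 0 x (by simp)) hp0.le
  have hUp : (fun x => U x ^ p) = fun x => ENNReal.ofReal (u x ^ p) := by
    funext x
    rw [hUu, ENNReal.ofReal_rpow_of_nonneg (hu0 x) hp0.le]
  have ha : Continuous (realAvg fun x => u x ^ p) := continuous_realAvg hfi
  have heqr : u = realAvg (realAvg fun x => u x ^ p) := by
    funext x
    have h1 : U x = ENNReal.ofReal (realAvg (realAvg fun x => u x ^ p) x) := by
      rw [heq, hUp, funext (avg_ofReal hfi hf0),
        avg_ofReal (fun a b => ha.intervalIntegrable a b) (realAvg_nonneg hf0)]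
    rw [hu]
    simp only [h1]
    exact ENNReal.toReal_ofReal (realAvg_nonneg (realAvg_nonneg hf0) x)
  refine ⟨u, ?_, hu0, hbell, ?_, ⟨x₀, ?_⟩, heqr⟩
  · rw [heqr]
    exact continuous_realAvg fun a b => ha.intervalIntegrable a b
  · have h1 : Tendsto (fun x : ℝ => C.toReal * (1 + |x|) ^ (-(p / (p + 1)))) atTop
        (𝓝 (C.toReal * 0)) := by
      refine Tendsto.const_mul _ ((tendsto_rpow_neg_atTop (by positivity)).comp ?_)
      exact tendsto_atTop_add_const_left _ _ tendsto_abs_atTop_atTop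
    rw [mul_zero] at h1
    refine squeeze_zero hu0 (fun x => ?_) h1
    have h2 := ENNReal.toReal_mono (ENNReal.mul_ne_top hC ENNReal.ofReal_ne_top) (hle x)
    have h3 : (ENNReal.ofReal ((1 + |x|) ^ (-(p / (p + 1))))).toReal = (1 + |x|) ^ (-(p / (p + 1))) :=
      ENNReal.toReal_ofReal (by positivity)
    rwa [ENNReal.toReal_mul, h3] at h2
  · exact (ENNReal.toReal_pos hx₀ (hUtop x₀)).ne'

namespace IsIntegralSolution

variable {p : ℝ} {u : ℝ → ℝ}

/-! ### Positivity and smoothness -/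

lemma even (h : IsIntegralSolution p u) : Function.Even u := fun x =>
  le_antisymm (h.bell _ _ (by simp)) (h.bell _ _ (by simp))

lemma antitoneOn (h : IsIntegralSolution p u) : AntitoneOn u (Ici 0) := fun x hx y hy hxy =>
  h.bell _ _ (by rwa [abs_of_nonneg hx, abs_of_nonneg hy])

lemma isBellShaped (h : IsIntegralSolution p u) : IsBellShaped u :=
  ⟨fun x hx y hy hxy => h.bell _ _ (by
    rw [abs_of_neg (mem_Iio.1 hx), abs_of_neg (mem_Iio.1 hy)]; linarith),
   h.antitoneOn.mono Ioi_subset_Ici_self⟩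

lemma continuous_rpow (h : IsIntegralSolution p u) (hp : 1 < p) : Continuous fun x => u x ^ p :=
  h.continuous.rpow_const fun _ => Or.inr (by linarith)

lemma continuous_avg_rpow (h : IsIntegralSolution p u) (hp : 1 < p) :
    Continuous (realAvg fun x => u x ^ p) :=
  continuous_realAvg fun a b => (h.continuous_rpow hp).intervalIntegrable a b

lemma rpow_nonneg (h : IsIntegralSolution p u) (x : ℝ) : 0 ≤ u x ^ p :=
  Real.rpow_nonneg (h.nonneg x) p

lemma antitoneOn_rpow (h : IsIntegralSolution p u) (hp : 1 < p) :
    AntitoneOn (fun x => u x ^ p) (Ici 0) := fun x hx y hy hxy =>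
  Real.rpow_le_rpow (h.nonneg y) (h.antitoneOn hx hy hxy) (by linarith)

/-- A zero of `u` would propagate: if `u x = 0` then the average of `u^p` vanishes near `x`, hence
`u` vanishes at a point closer to the origin by `1/2`. -/
lemma pos (h : IsIntegralSolution p u) (hp : 1 < p) (x : ℝ) : 0 < u x := by
  have hstep : ∀ x, 0 ≤ x → u x = 0 → u (max (x - 1 / 2) 0) = 0 := by
    intro x hx hux
    have ha := h.continuous_avg_rpow hp
    have ha0 := realAvg_nonneg h.rpow_nonneg
    have hzero : ∀ {g : ℝ → ℝ} (_ : Continuous g) (_ : ∀ t, 0 ≤ g t) {z : ℝ}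
        (_ : realAvg g z = 0) (t : ℝ) (_ : |t - z| < 1 / 2), g t = 0 := by
      intro g hg hg0 z hz t ht
      by_contra hne
      rw [abs_lt] at ht
      have hpos : 0 < realAvg g z :=
        intervalIntegral.integral_pos (by linarith) hg.continuousOn (fun s _ => hg0 s)
          ⟨t, ⟨by linarith [ht.1], by linarith [ht.2]⟩, lt_of_le_of_ne (hg0 t) (Ne.symm hne)⟩
      exact hpos.ne' hz
    have h1 : realAvg (realAvg fun x => u x ^ p) x = 0 := by rw [← h.eq_realAvg]; exact hux
    have h2 : ∀ t, |t - x| < 1 / 2 → realAvg (fun x => u x ^ p) t = 0 := hzero ha ha0 h1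
    have h3 : ∀ t, |t - x| < 1 → u t = 0 := by
      intro t ht
      have h4 := hzero (h.continuous_rpow hp) h.rpow_nonneg (h2 ((t + x) / 2) ?_) t ?_
      · exact (Real.rpow_eq_zero (h.nonneg t) (by linarith)).1 h4
      · rw [show (t + x) / 2 - x = (t - x) / 2 by ring, abs_div, abs_two]; linarith
      · rw [show t - (t + x) / 2 = (t - x) / 2 by ring, abs_div, abs_two]; linarith
    rcases le_total (x - 1 / 2) 0 with hx2 | hx2
    · rw [max_eq_right hx2]
      refine h3 0 ?_
      rw [zero_sub, abs_neg, abs_of_nonneg hx]; linarith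
    · rw [max_eq_left hx2]
      refine h3 _ ?_
      rw [show x - 1 / 2 - x = -(1 / 2) by ring, abs_neg, abs_of_pos] <;> norm_num
  have hzero : ∀ n : ℕ, ∀ x : ℝ, 0 ≤ x → x ≤ n / 2 → u x = 0 → u 0 = 0 := by
    intro n
    induction n with
    | zero =>
      intro x hx hx2 hux
      have : x = 0 := le_antisymm (by simpa using hx2) hx
      rwa [this] at hux
    | succ n ih =>
      intro x hx hx2 hux
      refine ih _ (le_max_right _ _) (max_le ?_ (by positivity)) (hstep x hx hux)
      push_cast at hx2
      linarith
  refine lt_of_le_of_ne (h.nonneg x) fun hux => ?_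
  have hux' : u |x| = 0 := by
    refine le_antisymm ?_ (h.nonneg _)
    rw [hux]
    exact h.bell _ _ (by simp)
  obtain ⟨n, hn⟩ := exists_nat_ge (2 * |x|)
  have h0 := hzero n |x| (abs_nonneg x) (by linarith) hux'
  obtain ⟨y, hy⟩ := h.exists_ne_zero
  exact hy (le_antisymm (h0 ▸ h.bell 0 y (by simp)) (h.nonneg y))

lemma contDiff_nat (h : IsIntegralSolution p u) (hp : 1 < p) (n : ℕ) : ContDiff ℝ n u := by
  induction n with
  | zero => exact contDiff_zero.2 h.continuous
  | succ n ih =>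
    have h1 : ContDiff ℝ n fun x => u x ^ p := ih.rpow_const_of_ne fun x => (h.pos hp x).ne'
    have h2 := contDiff_realAvg (contDiff_realAvg h1)
    rw [← h.eq_realAvg] at h2
    exact h2.of_le (by exact_mod_cast Nat.le_succ _)

lemma contDiff (h : IsIntegralSolution p u) (hp : 1 < p) : ContDiff ℝ ∞ u :=
  contDiff_infty.2 (h.contDiff_nat hp)

lemma contDiff_rpow (h : IsIntegralSolution p u) (hp : 1 < p) (n : ℕ) :
    ContDiff ℝ n fun x => u x ^ p :=
  (h.contDiff_nat hp n).rpow_const_of_ne fun x => (h.pos hp x).ne'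

lemma iteratedDeriv_add_two (h : IsIntegralSolution p u) (hp : 1 < p) (n : ℕ) (x : ℝ) :
    iteratedDeriv (n + 2) u x = iteratedDeriv n (fun x => u x ^ p) (x + 1) -
      2 * iteratedDeriv n (fun x => u x ^ p) x + iteratedDeriv n (fun x => u x ^ p) (x - 1) := by
  have h1 := h.contDiff_rpow hp n
  conv_lhs => rw [h.eq_realAvg]
  rw [iteratedDeriv_succ_realAvg (contDiff_realAvg h1), iteratedDeriv_succ_realAvg h1,
    iteratedDeriv_succ_realAvg h1]
  rw [show x + 1 / 2 + 1 / 2 = x + 1 by ring, show x + 1 / 2 - 1 / 2 = x by ring,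
    show x - 1 / 2 + 1 / 2 = x by ring, show x - 1 / 2 - 1 / 2 = x - 1 by ring]
  ring

lemma solvesAdvanceDelay (h : IsIntegralSolution p u) (hp : 1 < p) : SolvesAdvanceDelay p u := by
  refine ⟨h.contDiff hp, fun x => ?_⟩
  have h1 := h.iteratedDeriv_add_two hp 0 x
  simpa [iteratedDeriv_succ, iteratedDeriv_zero] using h1

end IsIntegralSolution

/-! ### Decay of all derivatives -/

/-- By homogeneity the bound reduces to the derivatives of `t ↦ t ^ p` at the single point `1`. -/
lemma exists_abs_iteratedDeriv_rpow_le (p : ℝ) (k : ℕ) : ∃ B : ℝ, 0 ≤ B ∧ ∀ u : ℝ → ℝ,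
    ContDiff ℝ k u → (∀ x, 0 < u x) → ∀ x D : ℝ,
    (∀ j, 1 ≤ j → j ≤ k → |iteratedDeriv j u x| ≤ D ^ j * u x) →
    |iteratedDeriv k (fun y => u y ^ p) x| ≤ B * D ^ k * u x ^ p := by
  set S := ∑ i ∈ Finset.range (k + 1), ‖iteratedFDerivWithin ℝ i (fun t : ℝ => t ^ p) (Ioi 0) 1‖
    with hS
  refine ⟨k.factorial * S, by positivity, fun u hu hpos x D hD => ?_⟩
  have hc : 0 < u x := hpos x
  have hφ : ContDiff ℝ k fun y => (u x)⁻¹ * u y := contDiff_const.mul hu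
  have hcomp : (fun y => u y ^ p) =
      fun y => u x ^ p * ((fun t : ℝ => t ^ p) ∘ fun y => (u x)⁻¹ * u y) y := by
    funext y
    simp only [Function.comp]
    rw [← Real.mul_rpow hc.le (mul_nonneg (inv_nonneg.2 hc.le) (hpos y).le),
      mul_inv_cancel_left₀ hc.ne']
  have hφ1 : (u x)⁻¹ * u x = 1 := inv_mul_cancel₀ hc.ne'
  have hφpos : ∀ y, 0 < (u x)⁻¹ * u y := fun y => mul_pos (inv_pos.2 hc) (hpos y)
  have hmain : ‖iteratedFDerivWithin ℝ k ((fun t : ℝ => t ^ p) ∘ fun y => (u x)⁻¹ * u y) univ x‖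
      ≤ k.factorial * S * D ^ k := by
    refine norm_iteratedFDerivWithin_comp_le (N := k) (t := Ioi 0) ?_ hφ.contDiffOn le_rfl
      isOpen_Ioi.uniqueDiffOn uniqueDiffOn_univ (fun y _ => hφpos y) (mem_univ x) ?_ ?_
    · exact fun t ht => (Real.contDiffAt_rpow_const_of_ne (ne_of_gt ht)).contDiffWithinAt
    · intro i hi
      simp only [hφ1]
      exact Finset.single_le_sum
        (f := fun i => ‖iteratedFDerivWithin ℝ i (fun t : ℝ => t ^ p) (Ioi 0) 1‖)
        (fun _ _ => norm_nonneg _) (Finset.mem_range.2 (by omega))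
    · intro j hj1 hjk
      rw [iteratedFDerivWithin_univ, norm_iteratedFDeriv_eq_norm_iteratedDeriv,
        iteratedDeriv_const_mul_field, Real.norm_eq_abs, abs_mul, abs_of_pos (inv_pos.2 hc),
        inv_mul_le_iff₀ hc, mul_comm]
      exact hD j hj1 hjk
  rw [iteratedFDerivWithin_univ, norm_iteratedFDeriv_eq_norm_iteratedDeriv, Real.norm_eq_abs]
    at hmain
  rw [hcomp, iteratedDeriv_const_mul_field, abs_mul, abs_of_pos (Real.rpow_pos_of_pos hc p),
    mul_comm]
  exact mul_le_mul_of_nonneg_right hmain (Real.rpow_pos_of_pos hc p).le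

namespace IsIntegralSolution

variable {p : ℝ} {u : ℝ → ℝ}

lemma rpow_pos (h : IsIntegralSolution p u) (hp : 1 < p) (x : ℝ) : 0 < u x ^ p :=
  Real.rpow_pos_of_pos (h.pos hp x) p

/-- The average of `u^p` is a mean over points at distance at most `1/2`. -/
lemma le_rpow_sub_one (h : IsIntegralSolution p u) (hp : 1 < p) {x : ℝ} (hx : 1 ≤ x) :
    u x ≤ u (x - 1) ^ p := by
  have ha := h.continuous_avg_rpow hp
  calc u x = realAvg (realAvg fun x => u x ^ p) x := congrFun h.eq_realAvg x
    _ ≤ u (x - 1) ^ p := by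
        refine realAvg_le ha fun t ht => realAvg_le (h.continuous_rpow hp) fun s hs => ?_
        rw [abs_le] at ht hs
        exact h.antitoneOn_rpow hp (by simp only [mem_Ici]; linarith)
          (by simp only [mem_Ici]; linarith) (by linarith)

/-- The ratio `u(y-1)^p / u(y)` grows by at most a constant factor when `y` increases by one.
With `k² = u(y) / u(y-1)^p`, the slope of `u` to the right of `y` is at most `2 u(y) / k`, so `u`
keeps half of its value on `[y, y + k/4]`, and this part of the graph bounds `u(y+1)` from below. -/
lemma mul_rpow_le (h : IsIntegralSolution p u) (hp : 1 < p) {y : ℝ} (hy : 1 ≤ y) :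
    u y * u y ^ p ≤ 64 * 2 ^ p * (u (y - 1) ^ p * u (y + 1)) := by
  have hp0 : 0 < p := by linarith
  set f := fun x => u x ^ p with hf
  have hfc : Continuous f := h.continuous_rpow hp
  have hf0 : ∀ x, 0 ≤ f x := h.rpow_nonneg
  have hfa : AntitoneOn f (Ici 0) := h.antitoneOn_rpow hp
  have hac : Continuous (realAvg f) := h.continuous_avg_rpow hp
  have ha0 : ∀ x, 0 ≤ realAvg f x := realAvg_nonneg hf0
  have haa : AntitoneOn (realAvg f) (Ici (0 + 1 / 2)) := antitoneOn_realAvg hfc hfa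
  have hu : ∀ x, u x = realAvg (realAvg f) x := congrFun h.eq_realAvg
  have hP : 0 < f (y - 1) := h.rpow_pos hp _
  have hU : 0 < u y := h.pos hp y
  set k := √(u y / f (y - 1)) with hk
  have hk0 : 0 < k := Real.sqrt_pos.2 (div_pos hU hP)
  have hk2 : k ^ 2 * f (y - 1) = u y := by
    rw [hk, Real.sq_sqrt (div_pos hU hP).le, div_mul_cancel₀ _ hP.ne']
  have hk1 : k ≤ 1 := by
    refine Real.sqrt_le_iff.2 ⟨zero_le_one, ?_⟩
    rw [one_pow, div_le_one hP]
    exact h.le_rpow_sub_one hp hy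
  -- the slope of `u` is controlled by the average of `u^p` over `[y - 1, y]`
  have h1 : k * realAvg f (y - 1 / 2 + k) ≤ u y := by
    rw [hu]; exact mul_le_realAvg hac ha0 haa (by linarith) hk0.le hk1
  have h2 : realAvg f (y - 1 / 2) - realAvg f (y - 1 / 2 + k) ≤ k * f (y - 1 / 2 - 1 / 2) :=
    realAvg_sub_le hfc hf0 hfa (by linarith) hk0.le
  rw [show y - 1 / 2 - 1 / 2 = y - 1 by ring] at h2
  have h3 : k * realAvg f (y - 1 / 2) ≤ 2 * u y := by
    have := mul_le_mul_of_nonneg_left h2 hk0.le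
    nlinarith
  have h4 : u y - u (y + k / 4) ≤ k / 4 * realAvg f (y - 1 / 2) := by
    rw [hu, hu]; exact realAvg_sub_le hac ha0 haa (by linarith) (by linarith)
  have h5 : u y / 2 ≤ u (y + k / 4) := by linarith
  -- the part of the graph over `[y, y + k/4]` bounds `u (y + 1)` from below
  have h6 : k / 8 * realAvg f (y + 1 - 1 / 2 + k / 8) ≤ u (y + 1) := by
    rw [hu]; exact mul_le_realAvg hac ha0 haa (by linarith) (by linarith) (by linarith)
  have h7 : k / 8 * f (y + k / 4) ≤ realAvg f (y + 1 - 1 / 2 + k / 8) := by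
    have := mul_le_realAvg hfc hf0 hfa (x := y + 1 - 1 / 2 + k / 8) (k := k / 8)
      (by linarith) (by linarith) (by linarith)
    rwa [show y + 1 - 1 / 2 + k / 8 - 1 / 2 + k / 8 = y + k / 4 by ring] at this
  have h8 : u y ^ p ≤ 2 ^ p * f (y + k / 4) := by
    have := Real.rpow_le_rpow (by linarith) h5 hp0.le
    rw [Real.div_rpow hU.le (by norm_num), div_le_iff₀ (by positivity)] at this
    rw [mul_comm]; exact this
  have h9 : k ^ 2 / 64 * f (y + k / 4) ≤ u (y + 1) := by
    have := mul_le_mul_of_nonneg_left h7 (by linarith : 0 ≤ k / 8)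
    nlinarith
  calc u y * u y ^ p ≤ u y * (2 ^ p * f (y + k / 4)) := by gcongr
    _ = 64 * 2 ^ p * (f (y - 1) * (k ^ 2 / 64 * f (y + k / 4))) := by rw [← hk2]; ring
    _ ≤ 64 * 2 ^ p * (f (y - 1) * u (y + 1)) := by gcongr

lemma exists_rpow_sub_one_le_pow (h : IsIntegralSolution p u) (hp : 1 < p) (n : ℕ) :
    ∀ y : ℝ, 1 ≤ y → y ≤ n + 2 →
      u (y - 1) ^ p ≤ u 0 ^ p / u 2 * (64 * 2 ^ p) ^ n * u y := by
  have hp0 : 0 < p := by linarith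
  have hM : (1:ℝ) ≤ 64 * 2 ^ p := by
    have := Real.one_le_rpow (by norm_num : (1:ℝ) ≤ 2) hp0.le
    linarith
  have hC : 0 < u 0 ^ p / u 2 := div_pos (h.rpow_pos hp 0) (h.pos hp 2)
  induction n with
  | zero =>
    intro y hy hy2
    rw [pow_zero, mul_one, div_mul_eq_mul_div, le_div_iff₀ (h.pos hp 2)]
    refine mul_le_mul (h.antitoneOn_rpow hp (by simp) ?_ (by linarith)) ?_ (h.nonneg _)
      (h.rpow_nonneg 0)
    · simp only [mem_Ici]; linarith
    · refine h.antitoneOn ?_ ?_ (by simpa using hy2)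
      · simp only [mem_Ici]; linarith
      · simp
  | succ n ih =>
    intro y hy hyn
    push_cast at hyn
    rcases le_total y (n + 2) with h1 | h1
    · refine (ih y hy h1).trans ?_
      have := h.pos hp y
      gcongr
      · exact n.le_succ
    · have hn : (0:ℝ) ≤ n := n.cast_nonneg
      have h2 := ih (y - 1) (by linarith) (by linarith)
      have h3 := h.mul_rpow_le hp (y := y - 1) (by linarith)
      rw [sub_add_cancel] at h3
      have h4 := h.pos hp (y - 1)
      have h5 := h.pos hp y
      refine le_of_mul_le_mul_left ?_ h4
      calc u (y - 1) * u (y - 1) ^ p ≤ 64 * 2 ^ p * (u (y - 1 - 1) ^ p * u y) := h3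
        _ ≤ 64 * 2 ^ p * ((u 0 ^ p / u 2 * (64 * 2 ^ p) ^ n * u (y - 1)) * u y) := by gcongr
        _ = _ := by ring

/-- A Harnack-type inequality: up to an exponential factor, `u x` dominates `u^p` on the whole
interval `[x - 1, x + 1]` that determines it. -/
lemma exists_rpow_le (h : IsIntegralSolution p u) (hp : 1 < p) :
    ∃ C K : ℝ, 0 ≤ C ∧ 0 ≤ K ∧ ∀ x t, |t - x| ≤ 1 → u t ^ p ≤ C * Real.exp (K * |x|) * u x := by
  have hp0 : 0 < p := by linarith
  set M : ℝ := 64 * 2 ^ p with hM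
  have hM1 : (1:ℝ) ≤ M := by
    have := Real.one_le_rpow (by norm_num : (1:ℝ) ≤ 2) hp0.le
    linarith
  have hM0 : 0 < M := by linarith
  set A := u 0 ^ p / u 2 with hA
  have hA0 : 0 < A := div_pos (h.rpow_pos hp 0) (h.pos hp 2)
  have hfb : ∀ s t, |s| ≤ |t| → u t ^ p ≤ u s ^ p := fun s t hst =>
    Real.rpow_le_rpow (h.nonneg t) (h.bell s t hst) hp0.le
  refine ⟨A, Real.log M, hA0.le, Real.log_nonneg hM1, fun x t ht => ?_⟩
  have htx : |x| - 1 ≤ |t| := by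
    have := abs_sub_abs_le_abs_sub x t
    rw [abs_sub_comm] at this
    linarith
  have hexp : 1 ≤ Real.exp (Real.log M * |x|) :=
    Real.one_le_exp (mul_nonneg (Real.log_nonneg hM1) (abs_nonneg x))
  have hux := h.pos hp x
  rcases le_total |x| 1 with hx | hx
  · have h1 := h.exists_rpow_sub_one_le_pow hp 0 1 le_rfl (by norm_num)
    rw [pow_zero, mul_one, sub_self] at h1
    calc u t ^ p ≤ u 0 ^ p := hfb _ _ (by simp)
      _ ≤ A * 1 * u 1 := by rw [mul_one]; exact h1
      _ ≤ A * Real.exp (Real.log M * |x|) * u x := by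
          gcongr
          · exact h.nonneg 1
          · exact h.bell _ _ (by rwa [abs_one])
  · have hfl := Nat.floor_le (sub_nonneg.2 hx)
    have h1 := h.exists_rpow_sub_one_le_pow hp ⌊|x| - 1⌋₊ |x| hx (by
      have := Nat.lt_floor_add_one (|x| - 1)
      linarith)
    have h2 : M ^ ⌊|x| - 1⌋₊ ≤ Real.exp (Real.log M * |x|) := by
      rw [← Real.rpow_natCast, Real.rpow_def_of_pos hM0]
      gcongr
      · exact Real.log_nonneg hM1
      · linarith
    calc u t ^ p ≤ u (|x| - 1) ^ p := hfb _ _ (by rwa [abs_of_nonneg (sub_nonneg.2 hx)])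
      _ ≤ A * M ^ ⌊|x| - 1⌋₊ * u |x| := h1
      _ ≤ A * Real.exp (Real.log M * |x|) * u x := by
          gcongr
          · exact h.nonneg _
          · exact h.bell _ _ (by simp)

/-- Every derivative is bounded by `u` itself up to an exponential factor. The derivatives of `u^p`
that appear in the equation involve negative powers of `u` when `p` is small; the Harnack-type
inequality absorbs them. -/
lemma exists_abs_iteratedDeriv_le (h : IsIntegralSolution p u) (hp : 1 < p) (n : ℕ) :
    ∃ C K : ℝ, 0 ≤ C ∧ 0 ≤ K ∧
      ∀ x, |iteratedDeriv n u x| ≤ C * Real.exp (K * |x|) * u x := by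
  obtain ⟨A, L, hA, hL, hAL⟩ := h.exists_rpow_le hp
  induction n using Nat.strong_induction_on with
  | _ n ih =>
  match n, ih with
  | 0, _ =>
    exact ⟨1, 0, zero_le_one, le_rfl, fun x => by
      rw [iteratedDeriv_zero, abs_of_pos (h.pos hp x)]; simp⟩
  | 1, _ =>
    refine ⟨A, L, hA, hL, fun x => ?_⟩
    have hd : iteratedDeriv 1 u x = realAvg (fun x => u x ^ p) (x + 1 / 2) -
        realAvg (fun x => u x ^ p) (x - 1 / 2) := by
      rw [iteratedDeriv_one]
      conv_lhs => rw [h.eq_realAvg]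
      rw [deriv_realAvg (h.continuous_avg_rpow hp)]
    have hb : ∀ z, |z - x| ≤ 1 / 2 →
        realAvg (fun x => u x ^ p) z ≤ A * Real.exp (L * |x|) * u x := fun z hz =>
      realAvg_le (h.continuous_rpow hp) fun t ht => hAL x t (by
        have := abs_add_le (t - z) (z - x)
        rw [sub_add_sub_cancel] at this
        linarith)
    have h1 := hb (x + 1 / 2) (by rw [add_sub_cancel_left, abs_of_pos (by norm_num)])
    have h2 := hb (x - 1 / 2) (by
      rw [show x - 1 / 2 - x = -(1 / 2) by ring, abs_neg, abs_of_pos (by norm_num)])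
    have h3 := realAvg_nonneg h.rpow_nonneg (x + 1 / 2)
    have h4 := realAvg_nonneg h.rpow_nonneg (x - 1 / 2)
    rw [hd, abs_le]
    constructor <;> linarith
  | k + 2, ih =>
    -- common constants for the derivatives of order at most `k`
    have hc : ∃ C K : ℝ, 1 ≤ C ∧ 0 ≤ K ∧ ∀ j ≤ k, ∀ x,
        |iteratedDeriv j u x| ≤ C * Real.exp (K * |x|) * u x := by
      choose! C K hC hK hCK using ih
      refine ⟨1 + ∑ j ∈ Finset.range (k + 1), C j, ∑ j ∈ Finset.range (k + 1), K j, ?_, ?_, ?_⟩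
      · have := Finset.sum_nonneg fun j (hj : j ∈ Finset.range (k + 1)) =>
          hC j (by have := Finset.mem_range.1 hj; omega)
        linarith
      · exact Finset.sum_nonneg fun j hj => hK j (by have := Finset.mem_range.1 hj; omega)
      · intro j hj x
        have hjr : j ∈ Finset.range (k + 1) := Finset.mem_range.2 (by omega)
        have h1 : C j ≤ ∑ j ∈ Finset.range (k + 1), C j :=
          Finset.single_le_sum (fun i hi => hC i (by have := Finset.mem_range.1 hi; omega)) hjr
        have h2 : K j ≤ ∑ j ∈ Finset.range (k + 1), K j :=
          Finset.single_le_sum (fun i hi => hK i (by have := Finset.mem_range.1 hi; omega)) hjr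
        have h3 := h.pos hp x
        have h4 := hC j (by omega)
        refine (hCK j (by omega) x).trans ?_
        gcongr <;> linarith
    obtain ⟨C, K, hC, hK, hCK⟩ := hc
    obtain ⟨B, hB, hBk⟩ := exists_abs_iteratedDeriv_rpow_le p k
    have hC0 : 0 ≤ C := by linarith
    have hf : ∀ x t, |t - x| ≤ 1 → |iteratedDeriv k (fun y => u y ^ p) t| ≤
        B * C ^ k * Real.exp (k * K) * A * Real.exp ((k * K + L) * |x|) * u x := by
      intro x t ht
      set D := C * Real.exp (K * |t|) with hD
      have hD1 : 1 ≤ D :=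
        one_le_mul_of_one_le_of_one_le hC (Real.one_le_exp (mul_nonneg hK (abs_nonneg t)))
      have h1 := hBk u (h.contDiff_nat hp k) (h.pos hp) t D fun j hj1 hjk => by
        have := h.pos hp t
        refine (hCK j hjk t).trans ?_
        gcongr
        exact le_self_pow₀ hD1 (by omega)
      have htx : |t| ≤ 1 + |x| := by
        have := abs_sub_abs_le_abs_sub t x
        linarith
      have h2 : D ^ k ≤ C ^ k * (Real.exp (k * K) * Real.exp (k * K * |x|)) := by
        rw [hD, mul_pow, ← Real.exp_nat_mul, ← Real.exp_add]
        gcongr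
        have : (0:ℝ) ≤ k * K := by positivity
        nlinarith
      calc |iteratedDeriv k (fun y => u y ^ p) t| ≤ B * D ^ k * u t ^ p := h1
        _ ≤ B * (C ^ k * (Real.exp (k * K) * Real.exp (k * K * |x|))) *
            (A * Real.exp (L * |x|) * u x) := by
            have := h.rpow_nonneg t
            gcongr
            exact hAL x t ht
        _ = B * C ^ k * Real.exp (k * K) * A * Real.exp ((k * K + L) * |x|) * u x := by
            rw [add_mul, Real.exp_add]; ring
    refine ⟨4 * (B * C ^ k * Real.exp (k * K) * A), k * K + L, by positivity, by positivity,
      fun x => ?_⟩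
    have h1 := abs_le.1 (hf x (x + 1) (by simp))
    have h2 := abs_le.1 (hf x x (by simp))
    have h3 := abs_le.1 (hf x (x - 1) (by simp))
    rw [h.iteratedDeriv_add_two hp, abs_le]
    constructor <;> linarith

/-- Decay at every exponential rate: far out, `u(x) ≤ u(x-1)^p` is a small multiple of `u(x-1)`. -/
lemma exists_le_exp_neg (h : IsIntegralSolution p u) (hp : 1 < p) {a : ℝ} (ha : 0 ≤ a) :
    ∃ C : ℝ, 0 ≤ C ∧ ∀ x, u x ≤ C * Real.exp (-a * |x|) := by
  have hp1 : 0 < p - 1 := by linarith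
  have hlim : Tendsto (fun x => u x ^ (p - 1)) atTop (𝓝 0) := by
    have := h.tendsto_zero.rpow_const (p := p - 1) (Or.inr hp1.le)
    rwa [Real.zero_rpow hp1.ne'] at this
  obtain ⟨N, hN⟩ := eventually_atTop.1 (hlim.eventually (gt_mem_nhds (Real.exp_pos (-a))))
  set X := max N 0 with hX
  have hX0 : 0 ≤ X := le_max_right _ _
  have hstep : ∀ x, X + 1 ≤ x → u x ≤ Real.exp (-a) * u (x - 1) := by
    intro x hx
    have h1 := hN (x - 1) (by have := le_max_left N 0; linarith)
    have h2 := h.pos hp (x - 1)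
    calc u x ≤ u (x - 1) ^ p := h.le_rpow_sub_one hp (by linarith)
      _ = u (x - 1) ^ (p - 1) * u (x - 1) := by
          rw [← Real.rpow_add_one h2.ne', sub_add_cancel]
      _ ≤ Real.exp (-a) * u (x - 1) := by gcongr
  set C := u 0 * Real.exp (a * (X + 1)) with hC
  have hmain : ∀ n : ℕ, ∀ x, 0 ≤ x → x ≤ X + 1 + n → u x ≤ C * Real.exp (-a * x) := by
    intro n
    induction n with
    | zero =>
      intro x hx hx2
      rw [Nat.cast_zero, add_zero] at hx2
      calc u x ≤ u 0 * 1 := by rw [mul_one]; exact h.bell 0 x (by simp)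
        _ ≤ u 0 * Real.exp (a * (X + 1) + -a * x) := by
            have := h.nonneg 0
            gcongr
            refine Real.one_le_exp ?_
            nlinarith
        _ = C * Real.exp (-a * x) := by rw [Real.exp_add, hC]; ring
    | succ n ih =>
      intro x hx hx2
      push_cast at hx2
      rcases le_total x (X + 1) with h1 | h1
      · exact ih x hx (h1.trans (by have : (0:ℝ) ≤ n := n.cast_nonneg; linarith))
      · calc u x ≤ Real.exp (-a) * u (x - 1) := hstep x h1
          _ ≤ Real.exp (-a) * (C * Real.exp (-a * (x - 1))) := by
              gcongr
              exact ih _ (by linarith) (by linarith)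
          _ = C * (Real.exp (-a) * Real.exp (-a * (x - 1))) := by ring
          _ = C * Real.exp (-a * x) := by rw [← Real.exp_add]; ring_nf
  refine ⟨C, mul_nonneg (h.nonneg 0) (Real.exp_pos _).le, fun x => ?_⟩
  obtain ⟨n, hn⟩ := exists_nat_ge |x|
  exact (h.bell |x| x (by simp)).trans (hmain n |x| (abs_nonneg x) (by linarith))

lemma exists_abs_pow_mul_iteratedDeriv_le (h : IsIntegralSolution p u) (hp : 1 < p) (k n : ℕ) :
    ∃ C : ℝ, ∀ x, |x| ^ k * |iteratedDeriv n u x| ≤ C := by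
  obtain ⟨C, K, hC, hK, hCK⟩ := h.exists_abs_iteratedDeriv_le hp n
  obtain ⟨A, hA, hAa⟩ := h.exists_le_exp_neg hp (a := K + 1) (by linarith)
  refine ⟨k.factorial * C * A, fun x => ?_⟩
  have h1 : |x| ^ k ≤ k.factorial * Real.exp |x| := by
    have := Real.pow_div_factorial_le_exp |x| (abs_nonneg x) k
    rwa [div_le_iff₀ (by positivity), mul_comm] at this
  calc |x| ^ k * |iteratedDeriv n u x|
      ≤ (k.factorial * Real.exp |x|) *
          (C * Real.exp (K * |x|) * (A * Real.exp (-(K + 1) * |x|))) := by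
        gcongr
        refine (hCK x).trans ?_
        gcongr
        exact hAa x
    _ = k.factorial * C * A *
          (Real.exp |x| * Real.exp (K * |x|) * Real.exp (-(K + 1) * |x|)) := by ring
    _ = k.factorial * C * A := by
        rw [← Real.exp_add, ← Real.exp_add]
        ring_nf
        simp

/-- The solution as a complex-valued Schwartz function. -/
noncomputable def toSchwartzMap (h : IsIntegralSolution p u) (hp : 1 < p) : 𝓢(ℝ, ℂ) where
  toFun x := (u x : ℂ)
  smooth' := Complex.ofRealCLM.contDiff.comp (h.contDiff hp)
  decay' k n := by
    obtain ⟨C, hC⟩ := h.exists_abs_pow_mul_iteratedDeriv_le hp k n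
    refine ⟨C, fun x => ?_⟩
    have h1 : ‖iteratedFDeriv ℝ n (fun x => (u x : ℂ)) x‖ = ‖iteratedFDeriv ℝ n u x‖ :=
      Complex.ofRealLI.norm_iteratedFDeriv_comp_left (h.contDiff_nat hp n).contDiffAt le_rfl
    rw [h1, norm_iteratedFDeriv_eq_norm_iteratedDeriv]
    exact hC x

lemma memHInfty (h : IsIntegralSolution p u) (hp : 1 < p) : MemHInfty u := by
  refine ⟨(h.toSchwartzMap hp).memLp 2 volume, fun s => ?_⟩
  have h1 := Lp.toTemperedDistribution_toLp_eq (μ := volume) (p := 2) (h.toSchwartzMap hp)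
  have h2 := (h.toSchwartzMap hp).memSobolev (s := s) (p := 2)
  rw [← h1] at h2
  exact h2

end IsIntegralSolution
end AdvanceDelay

theorem theorem1 (p : ℝ) (hp : 1 < p) :
    ∃ u : ℝ → ℝ,
      (∀ x : ℝ, 0 < u x) ∧
      SolvesAdvanceDelay p u ∧
      Function.Even u ∧
      IsBellShaped u ∧
      MemHInfty u := by
  obtain ⟨u, h⟩ := AdvanceDelay.exists_isIntegralSolution hp
  exact ⟨u, h.pos hp, h.solvesAdvanceDelay hp, h.even, h.isBellShaped, h.memHInfty hp⟩
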